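/- Let $G=(V,E)$ be a finite directed graph. For each $v\in V$ let $A_v$ and $Q_v$ be finite sets, and put $A=\bigsqcup_{v\in V}A_v$ and $Q=\prod_{v\in V}Q_v$. Let $\mathcal N$ be an abelian network on $G$ with alphabet $A$ and state space $Q$: each vertex $v$ carries commuting maps $t_a:Q_v\to Q_v$ $(a\in A_v)$ and functions $o_a^u:Q_v\to A_u^*$ $(a\in A_v,\ (v,u)\in E)$ such that, for every initial state and every $u$, two input words in $A_v^*$ that are equal up to permutation produce output words in $A_u^*$ that are equal up to permutation. Processing a letter $a\in A_v$ in a configuration $\mathbf y.\mathbf q\in\mathbb Z^A\times Q$ lowers $\mathbf y_a$ by one, adds to $\mathbf y$ the letters of the words $o_a^u(\mathbf q_v)$ for all $(v,u)\in E$, and replaces $\mathbf q_v$ by $t_a(\mathbf q_v)$. For $w\in A^*$ let $|w|\in\mathbb N^A$ count its letters. The configuration $\pi_w(\mathbf y.\mathbf q)$ obtained by processing the letters of $w$ in order depends only on $|w|$, and is also written $\pi_{|w|}(\mathbf y.\mathbf q)$. The word $w$ is \emph{legal} for $\mathbf y.\mathbf q$ if each of its letters $a$ is processed at a moment when the current $a$-coordinate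 is at least $1$, and \emph{complete} if no coordinate is positive after $w$ is processed. Assume that $\mathcal N$ \emph{halts on all inputs}, i.e. for all $\mathbf x\in\mathbb N^A$ and $\mathbf q\in Q$ there is a complete legal word $w$ for $\mathbf x.\mathbf q$. The \emph{odometer} is $[\mathbf x.\mathbf q]:=|w|\in\mathbb N^A$, and $\mathbf x\triangleright\!\triangleright\mathbf q\in Q$ denotes the final state; both are independent of the choice of $w$. Assume also that $\mathcal N$ is \emph{irreducible}, i.e. for every $v$, writing $M_v$ for the monoid of self-maps of $Q_v$ generated by $(t_a)_{a\in A_v}$, we have $Q_v\ne\emptyset$ and for all $q,q'\in Q_v$ there are $m,m'\in M_v$ with $mq=m'q'$. If a monoid $M$ acts on a set $X$, call $x\in X$ recurrent if $x\in M(mx)$ for all $m\in M$. Let $\mathrm{Rec}\,\mathcal N$ be the set of states in $Q$ that are recurrent for the monoid generated by the maps $\tau_a:\mathbf q\mapsto 1_a\triangleright\!\triangleright\mathbf q$ $(a\in A)$. Call $\mathbf q\in Q$ locally recurrent if each $\mathbf q_v$ is recurrent for $M_v$. The maps $t_a$ $(a\in A_v)$ permute the recurrent elements of $Q_v$; let $K_v\subseteq\mathbb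 Z^{A_v}$ be the kernel of the resulting action of $\mathbb Z^{A_v}$ on these elements, and let $K=\prod_{v}K_v\subseteq\mathbb Z^A$. For a locally recurrent state $\mathbf q_0$ and $\mathbf k\in K\cap\mathbb N^A$ we have $\pi_{\mathbf k}(\mathbf k.\mathbf q_0)=P_{\mathbf q_0}(\mathbf k).\mathbf q_0$ for a vector $P_{\mathbf q_0}(\mathbf k)\in\mathbb N^A$. Let $P$ be the $A\times A$ rational matrix of the linear extension of $P_{\mathbf q_0}$ to $\mathbb Q^A$; that is, column $b$ of $P$ is $P_{\mathbf q_0}(r_b1_b)/r_b$ with $r_b=\min\{m\ge1: m1_b\in K\}$. Then $\mathrm{Rec}\,\mathcal N$ is nonempty, locally recurrent states exist, and, for every choice of the locally recurrent state $\mathbf q_0$, the matrix $I-P$ is invertible and, if $\mathbf q$ is a uniformly random element of $\mathrm{Rec}\,\mathcal N$, $$\mathbb E\,[\mathbf x.\mathbf q]=(I-P)^{-1}\mathbf x\qquad\text{for all }\mathbf x\in\mathbb N^A.$$ -/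

import Mathlib

/-! ### Monoid actions -/

/-- An action is irreducible if the relation `x ∼ x'`, i.e. `m x = m' x'` for some `m, m'`, has
exactly one equivalence class. -/
def IsIrreducibleAction (M X : Type*) [Monoid M] [MulAction M X] : Prop :=
  Nonempty X ∧ ∀ x x' : X, ∃ m m' : M, m • x = m' • x'

/-- Recurrent elements: `x ∈ M (m x)` for every `m`. For a finite commutative monoid with minimal
idempotent `e` this says `x = e x`, equivalently `x ∈ e X`. -/
def IsRecurrentElt (M : Type*) {X : Type*} [Monoid M] [MulAction M X] (x : X) : Prop :=
  ∀ m : M, ∃ m' : M, m' • m • x = x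

/-- A monoid acting on a nonempty finite set has a recurrent element. -/
theorem exists_isRecurrentElt (M X : Type*) [Monoid M] [MulAction M X] [Finite X] [Nonempty X] :
    ∃ x : X, IsRecurrentElt M x := by
  obtain ⟨x, hx⟩ := Finite.exists_min (fun x : X => (MulAction.orbit M x).ncard)
  refine ⟨x, fun m => ?_⟩
  have hsub : MulAction.orbit M (m • x) ⊆ MulAction.orbit M x := by
    rintro _ ⟨n, rfl⟩
    exact ⟨n * m, mul_smul n m x⟩
  have heq := Set.eq_of_subset_of_ncard_le hsub (hx (m • x)) (Set.toFinite _)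
  have hmem : x ∈ MulAction.orbit M (m • x) := heq ▸ ⟨1, one_smul M x⟩
  exact hmem

/-! ### Abelian processors -/

/-- State reached from `q` after reading a word, given the transition maps `t`. -/
def runWord {I S : Type*} (t : I → S → S) : S → List I → S
  | q, [] => q
  | q, a :: w => runWord t (t a q) w

/-- Word emitted on an output feed with alphabet `B` while reading a word from state `q`. -/
def outWord {I S B : Type*} (t : I → S → S) (o : I → S → List B) : S → List I → List B
  | _, [] => []
  | q, a :: w => o a q ++ outWord t o (t a q) w

/-- An abelian processor with input alphabet `I`, state space `S` and output alphabets
`(B u)_{u : U}`. -/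
structure AbelianProcessor (I S : Type*) {U : Type*} (B : U → Type*) where
  /-- state transition maps -/
  t : I → Function.End S
  /-- message passing functions -/
  o : I → (u : U) → S → List (B u)
  /-- the transition maps commute -/
  t_comm : ∀ a b : I, t a * t b = t b * t a
  /-- input words equal up to permutation yield output words equal up to permutation -/
  o_perm : ∀ (q : S) (w w' : List I), w.Perm w' → ∀ u : U,
    (outWord t (fun a => o a u) q w).Perm (outWord t (fun a => o a u) q w')

namespace AbelianProcessor

/-- The transition monoid, generated by the transition maps. -/
def transitionMonoid {I S U : Type*} {B : U → Type*} (p : AbelianProcessor I S B) :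
    Submonoid (Function.End S) :=
  Submonoid.closure (Set.range p.t)

/-- The processor is irreducible if the action of its transition monoid is. -/
def Irreducible {I S U : Type*} {B : U → Type*} (p : AbelianProcessor I S B) : Prop :=
  IsIrreducibleAction p.transitionMonoid S

/-- The kernel of the action of `ℤ^I` on the recurrent states of the processor. Letters act on
these states by commuting permutations, so an integer vector `k = |w| - |w'|` acts as the
transformation of the word `w` followed by the inverse of the one of `w'`, and it acts trivially
when `w` and `w'` act in the same way. -/
def kernel {I S U : Type*} [DecidableEq I] {B : U → Type*} (p : AbelianProcessor I S B) :
    Set (I → ℤ) :=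
  {k | ∀ w w' : List I, (∀ a, k a = (w.count a : ℤ) - (w'.count a : ℤ)) →
    ∀ q : S, IsRecurrentElt p.transitionMonoid q → runWord p.t q w = runWord p.t q w'}

end AbelianProcessor

/-! ### Abelian networks -/

/-- An abelian network on the directed graph `G` with alphabets `A v` and state spaces `Q v`: an
abelian processor at each vertex `v`, with an output feed for each edge `(v, u)`, of alphabet
`A u`. The total alphabet is `Σ v, A v` and the total state space is `∀ v, Q v`. -/
structure AbelianNetwork {V : Type*} (G : Digraph V) (A Q : V → Type*) where
  /-- the processor at each vertex -/
  proc : ∀ v : V, AbelianProcessor (A v) (Q v) (fun u : {u : V // G.Adj v u} => A u.1)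

namespace AbelianNetwork

/-- The pairs `x.q`: letters waiting to be processed (negative entries are debts) and states. -/
abbrev Config {V : Type*} (A Q : V → Type*) : Type _ := ((Σ v, A v) → ℤ) × (∀ v, Q v)

/-- The vector counting the letters of a word. -/
def wordVec {V : Type*} {A : V → Type*} [DecidableEq V] [∀ v, DecidableEq (A v)]
    (w : List (Σ v, A v)) : (Σ v, A v) → ℕ :=
  fun a => w.count a

/-- A word with a prescribed number of occurrences of each letter. -/
noncomputable def vecWord {V : Type*} {A : V → Type*} [Fintype V] [∀ v, Fintype (A v)]
    (x : (Σ v, A v) → ℕ) : List (Σ v, A v) :=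
  (∑ a, x a • ({a} : Multiset (Σ v, A v))).toList

section

variable {V : Type*} {G : Digraph V} {A Q : V → Type*} [DecidableEq V] [∀ v, DecidableEq (A v)]

open Classical in
/-- The number of letters of each type passed when letter `a` is processed in state `q`. -/
noncomputable def message (N : AbelianNetwork G A Q) (a : Σ v, A v) (q : ∀ v, Q v) :
    (Σ v, A v) → ℕ :=
  fun b => if h : G.Adj a.1 b.1 then ((N.proc a.1).o a.2 ⟨b.1, h⟩ (q a.1)).count b.2 else 0

/-- Processing one letter `a` (whether or not such a letter is present). -/
noncomputable def step (N : AbelianNetwork G A Q) (a : Σ v, A v) (c : Config A Q) : Config A Q :=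
  (fun b => c.1 b - (if b = a then 1 else 0) + (N.message a c.2 b : ℤ),
    Function.update c.2 a.1 ((N.proc a.1).t a.2 (c.2 a.1)))

/-- The result `π_w(x.q)` of executing the word `w`. -/
noncomputable def exec (N : AbelianNetwork G A Q) : List (Σ v, A v) → Config A Q → Config A Q
  | [], c => c
  | a :: w, c => exec N w (N.step a c)

/-- A word is legal if each letter is present when it is processed. -/
def Legal (N : AbelianNetwork G A Q) : List (Σ v, A v) → Config A Q → Prop
  | [], _ => True
  | a :: w, c => 1 ≤ c.1 a ∧ Legal N w (N.step a c)

/-- A word is complete if no letters remain after it has been executed. -/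
def Complete (N : AbelianNetwork G A Q) (w : List (Σ v, A v)) (c : Config A Q) : Prop :=
  ∀ a, (N.exec w c).1 a ≤ 0

theorem step_comm (N : AbelianNetwork G A Q) (a b : Σ v, A v) (c : Config A Q) :
    N.step a (N.step b c) = N.step b (N.step a c) := by
  obtain ⟨v, a⟩ := a
  obtain ⟨u, b⟩ := b
  by_cases h : v = u
  · subst h
    have ht : (N.proc v).t a ((N.proc v).t b (c.2 v)) = (N.proc v).t b ((N.proc v).t a (c.2 v)) :=
      congrFun ((N.proc v).t_comm a b) (c.2 v)
    refine Prod.ext (funext fun d => ?_) ?_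
    · have hp : N.message ⟨v, b⟩ c.2 d + N.message ⟨v, a⟩ (N.step ⟨v, b⟩ c).2 d =
          N.message ⟨v, a⟩ c.2 d + N.message ⟨v, b⟩ (N.step ⟨v, a⟩ c).2 d := by
        by_cases hd : G.Adj v d.1
        · have := ((N.proc v).o_perm (c.2 v) [b, a] [a, b] (List.Perm.swap a b [])
            ⟨d.1, hd⟩).count_eq d.2
          simpa [message, step, hd, outWord] using this
        · simp [message, hd]
      have hp' : (N.message ⟨v, b⟩ c.2 d : ℤ) + N.message ⟨v, a⟩ (N.step ⟨v, b⟩ c).2 d =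
          N.message ⟨v, a⟩ c.2 d + N.message ⟨v, b⟩ (N.step ⟨v, a⟩ c).2 d := by exact_mod_cast hp
      simp only [step] at hp' ⊢
      linarith
    · simp [step, ht]
  · refine Prod.ext (funext fun d => ?_) ?_
    · simp only [step, message, Function.update_of_ne h, Function.update_of_ne (Ne.symm h)]
      ring
    · simp only [step, Function.update_of_ne h, Function.update_of_ne (Ne.symm h)]
      exact (Function.update_comm h _ _ _).symm

/-- The result of an execution depends only on the number of letters of each type. -/
theorem exec_perm (N : AbelianNetwork G A Q) {w w' : List (Σ v, A v)} (h : w.Perm w')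
    (c : Config A Q) : N.exec w c = N.exec w' c := by
  induction h generalizing c with
  | nil => rfl
  | cons a _ ih => exact ih _
  | swap a b l => simp only [exec, step_comm N a b c]
  | trans _ _ ih₁ ih₂ => exact (ih₁ c).trans (ih₂ c)

theorem le_exec_of_notMem (N : AbelianNetwork G A Q) (a : Σ v, A v) (w : List (Σ v, A v))
    (hw : a ∉ w) (c : Config A Q) : c.1 a ≤ (N.exec w c).1 a := by
  induction w generalizing c with
  | nil => exact le_rfl
  | cons b w ih =>
    rw [List.mem_cons, not_or] at hw
    refine le_trans ?_ (ih hw.2 (N.step b c))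
    simp [step, hw.1]

/-- A legal execution is contained in every complete execution. -/
theorem leastAction (N : AbelianNetwork G A Q) (w w' : List (Σ v, A v)) (c : Config A Q)
    (hw : N.Legal w c) (hw' : N.Complete w' c) (a : Σ v, A v) : w.count a ≤ w'.count a := by
  induction w generalizing w' c with
  | nil => simp
  | cons b w ih =>
    have hb : b ∈ w' := by
      by_contra hb
      have h1 := N.le_exec_of_notMem b w' hb c
      have h2 := hw' b
      have h3 := hw.1
      omega
    have hperm := List.perm_cons_erase hb
    have hc : N.Complete (w'.erase b) (N.step b c) := fun d => by
      have := hw' d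
      rwa [N.exec_perm hperm c] at this
    have := ih (w'.erase b) (N.step b c) hw.2 hc
    rw [hperm.count_eq a, List.count_cons, List.count_cons]
    omega

/-- The configuration `x.q` for `x ∈ ℕ^A`. -/
def config (x : (Σ v, A v) → ℕ) (q : ∀ v, Q v) : Config A Q := (fun a => (x a : ℤ), q)

/-- The network halts on all inputs. -/
def HaltsOnAllInputs (N : AbelianNetwork G A Q) : Prop :=
  ∀ (x : (Σ v, A v) → ℕ) (q : ∀ v, Q v), ∃ w, N.Legal w (config x q) ∧ N.Complete w (config x q)

/-- The network is irreducible: every processor is. -/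
def Irreducible (N : AbelianNetwork G A Q) : Prop := ∀ v, (N.proc v).Irreducible

/-- A complete legal execution for `x.q`. -/
noncomputable def haltingWord (N : AbelianNetwork G A Q) (h : N.HaltsOnAllInputs)
    (x : (Σ v, A v) → ℕ) (q : ∀ v, Q v) : List (Σ v, A v) :=
  Classical.choose (h x q)

/-- The odometer `[x.q]`: the number of letters of each type in a complete legal execution. -/
noncomputable def odometer (N : AbelianNetwork G A Q) (h : N.HaltsOnAllInputs)
    (x : (Σ v, A v) → ℕ) (q : ∀ v, Q v) : (Σ v, A v) → ℕ :=
  wordVec (N.haltingWord h x q)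

/-- The final state `x ▷▷ q`. -/
noncomputable def finalState (N : AbelianNetwork G A Q) (h : N.HaltsOnAllInputs)
    (x : (Σ v, A v) → ℕ) (q : ∀ v, Q v) : ∀ v, Q v :=
  (N.exec (N.haltingWord h x q) (config x q)).2

/-- The odometer and the final state may be computed with any complete legal execution. -/
theorem odometer_finalState_eq (N : AbelianNetwork G A Q) (h : N.HaltsOnAllInputs)
    (x : (Σ v, A v) → ℕ) (q : ∀ v, Q v) (w : List (Σ v, A v)) (hl : N.Legal w (config x q))
    (hc : N.Complete w (config x q)) :
    N.odometer h x q = wordVec w ∧ N.finalState h x q = (N.exec w (config x q)).2 := by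
  have hs := Classical.choose_spec (h x q)
  have hcount : ∀ a, (N.haltingWord h x q).count a = w.count a := fun a =>
    le_antisymm (N.leastAction _ _ _ hs.1 hc a) (N.leastAction _ _ _ hl hs.2 a)
  refine ⟨funext hcount, ?_⟩
  rw [finalState, N.exec_perm (List.perm_iff_count.2 hcount)]

/-- The map `τ_a : q ↦ 1_a ▷▷ q`. -/
noncomputable def tau (N : AbelianNetwork G A Q) (h : N.HaltsOnAllInputs) (a : Σ v, A v) :
    Function.End (∀ v, Q v) :=
  fun q => N.finalState h (Pi.single a 1) q

/-- The global monoid, generated by the maps `τ_a`. -/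
noncomputable def globalMonoid (N : AbelianNetwork G A Q) (h : N.HaltsOnAllInputs) :
    Submonoid (Function.End (∀ v, Q v)) :=
  Submonoid.closure (Set.range (N.tau h))

/-- The set of recurrent states. -/
def Rec (N : AbelianNetwork G A Q) (h : N.HaltsOnAllInputs) : Set (∀ v, Q v) :=
  {q | IsRecurrentElt (N.globalMonoid h) q}

/-- Locally recurrent states: each coordinate is recurrent for the local monoid. -/
def LocallyRecurrent (N : AbelianNetwork G A Q) (q : ∀ v, Q v) : Prop :=
  ∀ v, IsRecurrentElt (N.proc v).transitionMonoid (q v)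

/-- The total kernel `K = ∏ K_v`, as a subset of `ℤ^A`. -/
def totalKernel (N : AbelianNetwork G A Q) : Set ((Σ v, A v) → ℤ) :=
  {k | ∀ v, (fun a : A v => k ⟨v, a⟩) ∈ (N.proc v).kernel}

/-- The reset number `r_a`: the least `m ≥ 1` such that `m 1_a` lies in the total kernel. -/
noncomputable def resetNumber (N : AbelianNetwork G A Q) (a : Σ v, A v) : ℕ :=
  sInf {m : ℕ | 1 ≤ m ∧ (Pi.single a (m : ℤ) : (Σ v, A v) → ℤ) ∈ N.totalKernel}

variable [Fintype V] [∀ v, Fintype (A v)]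

/-- The local action `x ▷ (y.q) = π_x((x + y).q)`. -/
noncomputable def localAction (N : AbelianNetwork G A Q) (x : (Σ v, A v) → ℕ) (c : Config A Q) :
    Config A Q :=
  N.exec (vecWord x) (fun a => (x a : ℤ) + c.1 a, c.2)

/-- The vector `P_q(k)`, where `k ▷ q = P_q(k).q` for `k ∈ K ∩ ℕ^A`. -/
noncomputable def production (N : AbelianNetwork G A Q) (q : ∀ v, Q v) (k : (Σ v, A v) → ℕ) :
    (Σ v, A v) → ℤ :=
  (N.localAction k (0, q)).1

/-- The production matrix: the matrix of the linear map on `ℚ^A` extending `P_q`. As `r_b 1_b`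
lies in `K ∩ ℕ^A`, its column `b` is `P_q(r_b 1_b) / r_b`. -/
noncomputable def productionMatrix (N : AbelianNetwork G A Q) (q : ∀ v, Q v) :
    Matrix (Σ v, A v) (Σ v, A v) ℚ :=
  Matrix.of fun a b =>
    (N.production q (Pi.single b (N.resetNumber b)) a : ℚ) / (N.resetNumber b : ℚ)

variable [∀ v, Fintype (Q v)]

/-- The expected odometer `E[x.q]` for `q` uniformly distributed on the recurrent states. -/
noncomputable def expectedOdometer (N : AbelianNetwork G A Q) (h : N.HaltsOnAllInputs)
    (x : (Σ v, A v) → ℕ) : (Σ v, A v) → ℚ :=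
  fun a => (∑ q ∈ (Set.toFinite (N.Rec h)).toFinset, (N.odometer h x q a : ℚ)) /
    ((N.Rec h).ncard : ℚ)

end

end AbelianNetwork

/-! Up to a coboundary, an execution changes the waiting letters linearly, and averaging over the
recurrent states removes the coboundary.

Let `w` return a locally recurrent state `q₀` to itself. Repeat `w` `R` times, with `R` divisible by
all reset numbers, and reorder the result into blocks of `R` equal letters. Each block fixes `q₀`,
and the definition of `P` gives its effect, so `w` changes the letter counts by exactly `(P - I)|w|`
(`change_eq_drift`). Words act transitively on the locally recurrent states (`exists_run_eq`). The
deviation from `(P - I)|w|`, which vanishes on loops at `q₀`, is therefore a difference `φ(end) -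
φ(start)` (`exists_potential`).

A complete legal execution of `x.q` changes the counts by `-x`, and recurrent states are locally
recurrent (`locallyRecurrent_of_mem_Rec`). Hence `(I - P)[x.q] = x + φ(x ▷▷ q) - φ(q)` on `Rec`. As
`x` permutes `Rec` (`finalState_bijOn`), the terms in `φ` cancel in the mean
(`mulVec_expectedOdometer`). Taking `x = 1_b` for all `b` yields a right inverse of `I - P`. -/

/-! ### Local theory of a processor -/

namespace AbelianProcessor

variable {I S U : Type*} {B : U → Type*} (p : AbelianProcessor I S B)

/-- The state reached from `q` after reading a word. -/
def act (q : S) (w : List I) : S :=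
  runWord p.t q w

theorem act_cons (q : S) (a : I) (w : List I) : p.act q (a :: w) = p.act (p.t a q) w :=
  rfl

theorem act_append (q : S) (w w' : List I) : p.act q (w ++ w') = p.act (p.act q w) w' := by
  induction w generalizing q with
  | nil => rfl
  | cons a w ih => exact ih _

theorem act_perm {w w' : List I} (h : w.Perm w') (q : S) :
    p.act q w = p.act q w' := by
  induction h generalizing q with
  | nil => rfl
  | cons a _ ih => exact ih _
  | swap a b l =>
    change p.act ((p.t a * p.t b) q) l =
      p.act ((p.t b * p.t a) q) l
    rw [p.t_comm]
  | trans _ _ ih₁ ih₂ => exact (ih₁ q).trans (ih₂ q)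

theorem act_comm (q : S) (w w' : List I) :
    p.act (p.act q w) w' =
      p.act (p.act q w') w := by
  rw [← p.act_append, ← p.act_append, p.act_perm List.perm_append_comm]

theorem exists_smul_eq_act (w : List I) :
    ∃ m : p.transitionMonoid, ∀ q : S, m • q = p.act q w := by
  induction w with
  | nil => exact ⟨1, fun q => one_smul _ q⟩
  | cons a w ih =>
    obtain ⟨m, hm⟩ := ih
    refine ⟨m * ⟨p.t a, Submonoid.subset_closure ⟨a, rfl⟩⟩, fun q => ?_⟩
    rw [mul_smul, hm]
    rfl

theorem exists_act_eq_smul (m : p.transitionMonoid) :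
    ∃ w : List I, ∀ q : S, m • q = p.act q w := by
  obtain ⟨m, hm⟩ := m
  induction hm using Submonoid.closure_induction with
  | mem x hx =>
    obtain ⟨a, rfl⟩ := hx
    exact ⟨[a], fun q => rfl⟩
  | one => exact ⟨[], fun q => rfl⟩
  | mul x y hx hy ihx ihy =>
    obtain ⟨w, hw⟩ := ihx
    obtain ⟨w', hw'⟩ := ihy
    -- In `x * y` the map `y` acts first, so its word is read first.
    exact ⟨w' ++ w, fun q => by
      rw [p.act_append, ← hw', ← hw]
      exact mul_smul (⟨x, hx⟩ : p.transitionMonoid) ⟨y, hy⟩ q⟩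

/-- A state is recurrent if and only if the effect of every word can be undone. -/
theorem isRecurrentElt_iff (q : S) :
    IsRecurrentElt p.transitionMonoid q ↔
      ∀ w, ∃ w', p.act (p.act q w) w' = q := by
  constructor
  · intro h w
    obtain ⟨m, hm⟩ := p.exists_smul_eq_act w
    obtain ⟨m', hm'⟩ := h m
    obtain ⟨w', hw'⟩ := p.exists_act_eq_smul m'
    exact ⟨w', by rw [← hm, ← hw', hm']⟩
  · intro h m
    obtain ⟨w, hw⟩ := p.exists_act_eq_smul m
    obtain ⟨w', hw'⟩ := h w
    obtain ⟨m', hm'⟩ := p.exists_smul_eq_act w'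
    exact ⟨m', by rw [hm', hw, hw']⟩

theorem isRecurrentElt_act {q : S} (h : IsRecurrentElt p.transitionMonoid q) (w : List I) :
    IsRecurrentElt p.transitionMonoid (p.act q w) := by
  rw [isRecurrentElt_iff] at h ⊢
  intro z
  obtain ⟨w', hw'⟩ := h (w ++ z)
  refine ⟨w' ++ w, ?_⟩
  rw [p.act_append, ← p.act_append q, hw']

/-- A state fixed by a word containing every letter is recurrent. -/
theorem isRecurrentElt_of_act_eq [DecidableEq I] {u : List I} (hu : ∀ a, a ∈ u) {q : S}
    (hq : p.act q u = q) : IsRecurrentElt p.transitionMonoid q := by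
  rw [isRecurrentElt_iff]
  intro z
  induction z generalizing q with
  | nil => exact ⟨[], rfl⟩
  | cons a z ih =>
    -- Words commute, so `u` still fixes the state after the letter `a`.
    have hfix : p.act (p.act q [a]) u =
        p.act q [a] := by
      rw [act_comm, hq]
    obtain ⟨u', hu'⟩ := ih hfix
    -- `u'` undoes `z`; the rest of `u` then completes `a` to a permutation of `u`, which fixes `q`.
    refine ⟨u' ++ u.erase a, ?_⟩
    rw [p.act_append]
    change p.act (p.act (p.act (p.act q [a]) z) u') _ = q
    rw [hu', ← p.act_append]
    refine Eq.trans ?_ hq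
    exact p.act_perm (List.perm_cons_erase (hu a)).symm q

theorem exists_act_eq (hp : p.Irreducible) (q : S) {q' : S}
    (h' : IsRecurrentElt p.transitionMonoid q') : ∃ w, p.act q w = q' := by
  obtain ⟨m, m', hm⟩ := hp.2 q q'
  -- `n` undoes `m'` on `q'`, so `n m q = n m' q' = q'`.
  obtain ⟨n, hn⟩ := h' m'
  obtain ⟨w, hw⟩ := p.exists_act_eq_smul (n * m)
  exact ⟨w, by rw [← hw, mul_smul, hm, hn]⟩

/-- Each letter has a power which acts trivially on the recurrent states. -/
theorem exists_replicate_fixes [Finite S] (a : I) :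
    ∃ n : ℕ, 1 ≤ n ∧ ∀ q, IsRecurrentElt p.transitionMonoid q →
      p.act q (List.replicate n a) = q := by
  -- By pigeonhole two powers of `a` act equally on `S`; on recurrent states the smaller one can be
  -- cancelled.
  obtain ⟨i, j, hij, h⟩ := Finite.exists_ne_map_eq_of_infinite
    (fun n : ℕ => fun q : S => p.act q (List.replicate n a))
  wlog hlt : i < j generalizing i j
  · exact this j i hij.symm h.symm (by omega)
  refine ⟨j - i, by omega, fun q hq => ?_⟩
  obtain ⟨w, hw⟩ := (p.isRecurrentElt_iff q).1 hq (List.replicate i a)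
  have h1 := congrFun h q
  have h2 : List.replicate j a = List.replicate i a ++ List.replicate (j - i) a := by
    rw [List.replicate_append_replicate]
    congr 1
    omega
  simp only [h2, p.act_append] at h1
  have h3 := congrArg (fun s => p.act s w) h1
  rw [p.act_comm _ (List.replicate (j - i) a) w, hw] at h3
  exact h3.symm

/-- If `|w| - |w'| = n 1_a`, then `w` is a permutation of `w'` preceded by `n` letters `a`. -/
theorem single_mem_kernel [DecidableEq I] (a : I) (n : ℕ)
    (h : ∀ q, IsRecurrentElt p.transitionMonoid q →
      p.act q (List.replicate n a) = q) :
    (Pi.single a (n : ℤ) : I → ℤ) ∈ p.kernel := by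
  intro w w' hw q hq
  have hperm : w.Perm (List.replicate n a ++ w') := by
    rw [List.perm_iff_count]
    intro b
    have := hw b
    rw [List.count_append, List.count_replicate]
    rcases eq_or_ne b a with rfl | hb
    · simp at this ⊢
      omega
    · simp [hb.symm] at this ⊢
      omega
  exact (p.act_perm hperm q).trans (by rw [p.act_append, h q hq]; rfl)

theorem act_replicate_of_single_mem_kernel [DecidableEq I] (a : I) (n : ℕ)
    (h : (Pi.single a (n : ℤ) : I → ℤ) ∈ p.kernel) {q : S}
    (hq : IsRecurrentElt p.transitionMonoid q) :
    p.act q (List.replicate n a) = q := by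
  refine h (List.replicate n a) [] (fun b => ?_) q hq
  rcases eq_or_ne b a with rfl | hb
  · simp
  · simp [List.count_replicate, hb.symm]

end AbelianProcessor

namespace AbelianNetwork

theorem exists_locallyRecurrent {V : Type*} {G : Digraph V} {A Q : V → Type*}
    (N : AbelianNetwork G A Q) [∀ v, Finite (Q v)] (hirr : N.Irreducible) :
    ∃ q, N.LocallyRecurrent q := by
  have h : ∀ v, ∃ x : Q v, IsRecurrentElt (N.proc v).transitionMonoid x := fun v =>
    haveI := (hirr v).1
    exists_isRecurrentElt _ _
  choose q hq using h
  exact ⟨q, hq⟩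

section

variable {V : Type*} {G : Digraph V} {A Q : V → Type*} [DecidableEq V] [∀ v, DecidableEq (A v)]
  (N : AbelianNetwork G A Q)

/-! ### Executions -/

theorem exec_append (w w' : List (Σ v, A v)) (c : Config A Q) :
    N.exec (w ++ w') c = N.exec w' (N.exec w c) := by
  induction w generalizing c with
  | nil => rfl
  | cons a w ih => exact ih _

/-- The state reached from `q` after executing a word. -/
noncomputable def run (w : List (Σ v, A v)) (q : ∀ v, Q v) : ∀ v, Q v :=
  (N.exec w (0, q)).2

/-- The net change in the number of waiting letters when a word is executed from state `q`. -/
noncomputable def change (w : List (Σ v, A v)) (q : ∀ v, Q v) : (Σ v, A v) → ℤ :=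
  (N.exec w (0, q)).1

/-- Messages depend only on the state, so extra letters pass through unchanged. This is what
separates `change` and `run` from the initial letters. -/
theorem exec_add (w : List (Σ v, A v)) (y z : (Σ v, A v) → ℤ) (q : ∀ v, Q v) :
    N.exec w (y + z, q) = (y + (N.exec w (z, q)).1, (N.exec w (z, q)).2) := by
  induction w generalizing z q with
  | nil => rfl
  | cons a w ih =>
    have hs : N.step a (y + z, q) = (y + (N.step a (z, q)).1, (N.step a (z, q)).2) := by
      refine Prod.ext (funext fun b => ?_) rfl
      simp only [step, Pi.add_apply]
      ring
    simp only [exec]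
    rw [hs, ih]

theorem exec_eq (w : List (Σ v, A v)) (c : Config A Q) :
    N.exec w c = (c.1 + N.change w c.2, N.run w c.2) := by
  simpa [change, run] using N.exec_add w c.1 0 c.2

theorem run_append (w w' : List (Σ v, A v)) (q : ∀ v, Q v) :
    N.run (w ++ w') q = N.run w' (N.run w q) := by
  simp only [run, exec_append]
  rw [exec_eq]
  rfl

theorem change_append (w w' : List (Σ v, A v)) (q : ∀ v, Q v) :
    N.change (w ++ w') q = N.change w q + N.change w' (N.run w q) := by
  simp only [change, exec_append]
  rw [exec_eq]
  rfl

theorem change_perm {w w' : List (Σ v, A v)} (h : w.Perm w') (q : ∀ v, Q v) :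
    N.change w q = N.change w' q := by
  rw [change, change, N.exec_perm h]

theorem run_cons (a : Σ v, A v) (w : List (Σ v, A v)) (q : ∀ v, Q v) :
    N.run (a :: w) q = N.run w (Function.update q a.1 ((N.proc a.1).t a.2 (q a.1))) :=
  N.run_append [a] w q

theorem run_map_mk (v : V) (w : List (A v)) (q : ∀ v, Q v) :
    N.run (w.map (Sigma.mk v)) q =
      Function.update q v ((N.proc v).act (q v) w) := by
  induction w generalizing q with
  | nil => exact (Function.update_eq_self v q).symm
  | cons a w ih =>
    rw [List.map_cons, run_cons, ih]
    simp [AbelianProcessor.act_cons]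

/-- A word acts on the state at `v` through its letters in the alphabet of `v`. -/
theorem exists_run_apply_eq (w : List (Σ v, A v)) (v : V) :
    ∃ u : List (A v), (∀ a, ⟨v, a⟩ ∈ w → a ∈ u) ∧
      ∀ q, N.run w q v = (N.proc v).act (q v) u := by
  induction w with
  | nil => exact ⟨[], by simp, fun q => rfl⟩
  | cons b w ih =>
    obtain ⟨u, hu, hr⟩ := ih
    obtain ⟨v', b⟩ := b
    rcases eq_or_ne v v' with rfl | hv
    · refine ⟨b :: u, fun a ha => ?_, fun q => ?_⟩
      · rcases List.mem_cons.1 ha with h | h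
        · simp at h
          simp [h]
        · exact List.mem_cons_of_mem _ (hu a h)
      · rw [run_cons, hr]
        simp [AbelianProcessor.act_cons]
    · refine ⟨u, fun a ha => ?_, fun q => ?_⟩
      · rcases List.mem_cons.1 ha with h | h
        · exact absurd (congrArg Sigma.fst h) hv
        · exact hu a h
      · rw [run_cons, hr]
        simp [Function.update_of_ne hv]

theorem LocallyRecurrent.run {q : ∀ v, Q v} (hq : N.LocallyRecurrent q) (w : List (Σ v, A v)) :
    N.LocallyRecurrent (N.run w q) := by
  intro v
  obtain ⟨u, -, hu⟩ := N.exists_run_apply_eq w v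
  rw [hu]
  exact (N.proc v).isRecurrentElt_act (hq v) u

/-- Words act transitively on the locally recurrent states. -/
theorem exists_run_eq [Fintype V] (hirr : N.Irreducible) (q : ∀ v, Q v) {q' : ∀ v, Q v}
    (hq' : N.LocallyRecurrent q') : ∃ w, N.run w q = q' := by
  -- Vertices are corrected one at a time: letters at `v` alter no other coordinate.
  have key : ∀ s : Finset V, ∃ w, ∀ v ∈ s, N.run w q v = q' v := by
    intro s
    induction s using Finset.induction_on with
    | empty => exact ⟨[], by simp⟩
    | insert v s hv ih =>
      obtain ⟨w, hw⟩ := ih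
      obtain ⟨u, hu⟩ := (N.proc v).exists_act_eq (hirr v) (N.run w q v) (hq' v)
      refine ⟨w ++ u.map (Sigma.mk v), fun x hx => ?_⟩
      rw [run_append, run_map_mk, hu]
      rcases eq_or_ne x v with rfl | hxv
      · simp
      · rw [Function.update_of_ne hxv]
        exact hw x ((Finset.mem_insert.1 hx).resolve_left hxv)
  obtain ⟨w, hw⟩ := key Finset.univ
  exact ⟨w, funext fun v => hw v (Finset.mem_univ v)⟩

theorem run_flatten_replicate {w : List (Σ v, A v)} {q : ∀ v, Q v} (h : N.run w q = q) (n : ℕ) :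
    N.run (List.replicate n w).flatten q = q ∧
      N.change (List.replicate n w).flatten q = n • N.change w q := by
  induction n with
  | zero => exact ⟨rfl, by simp [change, exec]⟩
  | succ n ih =>
    rw [List.replicate_succ, List.flatten_cons, run_append, change_append, h, ih.1, ih.2, succ_nsmul']
    exact ⟨rfl, rfl⟩

/-! ### Reset numbers and the production matrix -/

theorem resetNumber_spec [∀ v, Finite (Q v)] (a : Σ v, A v) :
    1 ≤ N.resetNumber a ∧
      (Pi.single a (N.resetNumber a : ℤ) : (Σ v, A v) → ℤ) ∈ N.totalKernel := by
  apply Nat.sInf_mem (s := {m : ℕ | 1 ≤ m ∧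
    (Pi.single a (m : ℤ) : (Σ v, A v) → ℤ) ∈ N.totalKernel})
  obtain ⟨v, a⟩ := a
  obtain ⟨n, hn, h⟩ := (N.proc v).exists_replicate_fixes a
  refine ⟨n, hn, fun u => ?_⟩
  rcases eq_or_ne u v with rfl | hu
  · have := (N.proc u).single_mem_kernel a n h
    convert this using 1
    funext b
    simp [Pi.single_apply]
  -- At a vertex other than that of `a` the vector is zero, so `w` and `w'` have equal counts.
  · intro w w' hw q _
    refine (N.proc u).act_perm (List.perm_iff_count.2 fun b => ?_) q
    have := hw b
    simp only [Pi.single_apply, Sigma.mk.injEq, hu, false_and, if_false] at this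
    omega

theorem run_replicate_resetNumber [∀ v, Finite (Q v)] (a : Σ v, A v) {q : ∀ v, Q v}
    (hq : N.LocallyRecurrent q) : N.run (List.replicate (N.resetNumber a) a) q = q := by
  have hk := (N.resetNumber_spec a).2 a.1
  have hk' : (Pi.single a.2 (N.resetNumber a : ℤ) : A a.1 → ℤ) ∈ (N.proc a.1).kernel := by
    convert hk using 1
    funext b
    obtain ⟨v, a⟩ := a
    simp [Pi.single_apply]
  have := N.run_map_mk a.1 (List.replicate (N.resetNumber a) a.2) q
  rw [List.map_replicate, (N.proc a.1).act_replicate_of_single_mem_kernel _ _ hk' (hq a.1),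
    Function.update_eq_self] at this
  exact this

/-! ### Linear part of an execution: drift and potential. -/

variable [Fintype V] [∀ v, Fintype (A v)]

theorem vecWord_single_perm (b : Σ v, A v) (n : ℕ) :
    (vecWord (Pi.single b n)).Perm (List.replicate n b) := by
  rw [← Multiset.coe_eq_coe, vecWord, Multiset.coe_toList,
    Finset.sum_eq_single b (fun a _ ha => by simp [Pi.single_eq_of_ne ha]) (by simp)]
  simp [Multiset.nsmul_singleton, Multiset.coe_replicate]

/-- Executing a letter as often as its reset number changes the waiting letters according to the
matrix `P - I`. -/
theorem change_replicate_resetNumber [∀ v, Finite (Q v)] (b : Σ v, A v) (q : ∀ v, Q v)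
    (a : Σ v, A v) :
    (N.change (List.replicate (N.resetNumber b) b) q a : ℚ) =
      N.resetNumber b * (N.productionMatrix q - 1) a b := by
  have hr : (N.resetNumber b : ℚ) ≠ 0 := by
    have := (N.resetNumber_spec b).1
    positivity
  -- `production` starts with the `r_b` letters already waiting, whereas `change` starts from zero;
  -- this accounts for the `- I`.
  have hp : N.production q (Pi.single b (N.resetNumber b)) a =
      (Pi.single b (N.resetNumber b) : (Σ v, A v) → ℕ) a +
        N.change (List.replicate (N.resetNumber b) b) q a := by
    rw [production, localAction, N.exec_eq, N.change_perm (vecWord_single_perm b _)]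
    simp
  rw [Matrix.sub_apply, productionMatrix, Matrix.of_apply, hp, mul_sub]
  push_cast
  rw [mul_div_cancel₀ _ hr]
  rcases eq_or_ne a b with rfl | hab
  · simp
  · simp [Pi.single_eq_of_ne hab, Matrix.one_apply_ne hab]

/-- The vector `(P - I) |w|`. -/
noncomputable def drift (q : ∀ v, Q v) (w : List (Σ v, A v)) : (Σ v, A v) → ℚ :=
  (N.productionMatrix q - 1).mulVec fun b => (w.count b : ℚ)

theorem drift_append (q : ∀ v, Q v) (w w' : List (Σ v, A v)) :
    N.drift q (w ++ w') = N.drift q w + N.drift q w' := by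
  rw [drift, drift, drift, ← Matrix.mulVec_add]
  congr 1
  funext b
  simp

theorem drift_singleton (q : ∀ v, Q v) (b a : Σ v, A v) :
    N.drift q [b] a = (N.productionMatrix q - 1) a b := by
  have : (fun c => (([b] : List (Σ v, A v)).count c : ℚ)) = Pi.single b 1 := by
    funext c
    simp only [List.count_singleton, Pi.single_apply, beq_iff_eq, eq_comm (a := b)]
    split_ifs <;> simp
  rw [drift, this, Matrix.mulVec_single_one]
  rfl

/-- A word which fixes a locally recurrent state `q` changes the waiting letters according to the
matrix `P - I`. -/
theorem change_eq_drift [∀ v, Finite (Q v)] {q : ∀ v, Q v} (hq : N.LocallyRecurrent q)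
    {w : List (Σ v, A v)} (hw : N.run w q = q) (a : Σ v, A v) :
    (N.change w q a : ℚ) = N.drift q w a := by
  -- A common multiple of the reset numbers: `R` copies of any letter fix `q`.
  set R : ℕ := ∏ b, N.resetNumber b with hR
  have hR0 : (R : ℚ) ≠ 0 := by
    rw [hR, Nat.cast_ne_zero, Finset.prod_ne_zero_iff]
    intro b _
    have := (N.resetNumber_spec b).1
    omega
  have hletter : ∀ b, N.run (List.replicate R b) q = q ∧
      (N.change (List.replicate R b) q a : ℚ) = R * (N.productionMatrix q - 1) a b := by
    intro b
    obtain ⟨j, hj⟩ : N.resetNumber b ∣ R := Finset.dvd_prod_of_mem _ (Finset.mem_univ b)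
    obtain ⟨h1, h2⟩ := N.run_flatten_replicate (N.run_replicate_resetNumber b hq) j
    rw [List.flatten_replicate_replicate, mul_comm j, ← hj] at h1 h2
    refine ⟨h1, ?_⟩
    rw [h2, hj]
    have := N.change_replicate_resetNumber b q a
    simp only [Pi.smul_apply, nsmul_eq_mul]
    push_cast
    rw [this]
    ring
  have hpow : ∀ u : List (Σ v, A v), N.run (u.flatMap (List.replicate R)) q = q ∧
      (N.change (u.flatMap (List.replicate R)) q a : ℚ) = R * N.drift q u a := by
    intro u
    induction u with
    | nil => exact ⟨rfl, by simp [change, exec, drift, Matrix.mulVec, dotProduct]⟩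
    | cons b u ih =>
      rw [List.flatMap_cons, run_append, change_append, (hletter b).1]
      refine ⟨ih.1, ?_⟩
      rw [← List.singleton_append, drift_append, Pi.add_apply, Pi.add_apply, Int.cast_add,
        (hletter b).2, ih.2, drift_singleton]
      ring
  -- Both words contain each letter of `w` `R` times as often; comparing their changes and dividing
  -- by `R` gives the claim.
  have hperm : (w.flatMap (List.replicate R)).Perm (List.replicate R w).flatten := by
    rw [List.perm_iff_count]
    intro b
    rw [List.count_flatten, List.map_replicate, List.sum_replicate, smul_eq_mul]
    clear hw
    induction w with
    | nil => simp
    | cons c w ih =>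
      rw [List.flatMap_cons, List.count_append, ih, List.count_replicate, List.count_cons]
      by_cases hcb : c = b
      · simp [hcb]
        ring
      · simp [hcb]
  have h := (hpow w).2
  rw [N.change_perm hperm, (N.run_flatten_replicate hw R).2] at h
  simp only [Pi.smul_apply, nsmul_eq_mul] at h
  push_cast at h
  exact mul_left_cancel₀ hR0 h

/-- On locally recurrent states, the change of the waiting letters equals the drift up to a
coboundary. -/
theorem exists_potential [∀ v, Finite (Q v)] (hirr : N.Irreducible) {q₀ : ∀ v, Q v}
    (hq₀ : N.LocallyRecurrent q₀) :
    ∃ φ : (∀ v, Q v) → (Σ v, A v) → ℚ, ∀ q, N.LocallyRecurrent q → ∀ w a,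
      (N.change w q a : ℚ) = N.drift q₀ w a + φ (N.run w q) a - φ q a := by
  have h : ∀ q, ∃ u, N.LocallyRecurrent q → N.run u q₀ = q := fun q => by
    by_cases hq : N.LocallyRecurrent q
    · obtain ⟨u, hu⟩ := N.exists_run_eq hirr q₀ hq
      exact ⟨u, fun _ => hu⟩
    · exact ⟨[], fun h => absurd h hq⟩
  choose u hu using h
  -- The potential at `q` is the deviation from linearity along a chosen path `u q` from `q₀`.
  refine ⟨fun q a => N.change (u q) q₀ a - N.drift q₀ (u q) a, fun q hq w a => ?_⟩
  -- The same return path `z` closes two loops at `q₀`, one through `q` and `w`, the other along the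
  -- chosen path to `N.run w q`; its contribution cancels in the difference.
  obtain ⟨z, hz⟩ := N.exists_run_eq hirr (N.run w q) hq₀
  have h1 := N.change_eq_drift hq₀ (w := u q ++ (w ++ z))
    (by rw [run_append, run_append, hu q hq, hz]) a
  have h2 := N.change_eq_drift hq₀ (w := u (N.run w q) ++ z)
    (by rw [run_append, hu _ (hq.run N w), hz]) a
  simp only [change_append, drift_append, Pi.add_apply, Int.cast_add, hu q hq,
    hu _ (hq.run N w)] at h1 h2
  linarith

end

/-! ### The global action -/

section

variable {V : Type*} {G : Digraph V} {A Q : V → Type*} [DecidableEq V] [∀ v, DecidableEq (A v)]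
  (N : AbelianNetwork G A Q) (h : N.HaltsOnAllInputs)

theorem Legal.exec_nonneg {w : List (Σ v, A v)} {c : Config A Q} (hw : N.Legal w c)
    (hc : ∀ a, 0 ≤ c.1 a) (a : Σ v, A v) : 0 ≤ (N.exec w c).1 a := by
  induction w generalizing c with
  | nil => exact hc a
  | cons b w ih =>
    refine ih hw.2 fun d => ?_
    have h1 := hw.1
    have h2 := hc d
    simp only [step]
    split_ifs with hd
    · subst hd
      omega
    · omega

theorem Legal.append {w w' : List (Σ v, A v)} {c : Config A Q} (hw : N.Legal w c)
    (hw' : N.Legal w' (N.exec w c)) : N.Legal (w ++ w') c := by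
  induction w generalizing c with
  | nil => exact hw'
  | cons b w ih => exact ⟨hw.1, ih hw.2 hw'⟩

theorem Legal.add {w : List (Σ v, A v)} {z : (Σ v, A v) → ℤ} {q : ∀ v, Q v}
    (hw : N.Legal w (z, q)) {y : (Σ v, A v) → ℤ} (hy : ∀ a, 0 ≤ y a) :
    N.Legal w (y + z, q) := by
  induction w generalizing z q with
  | nil => trivial
  | cons b w ih =>
    refine ⟨?_, ?_⟩
    · have h1 := hw.1
      have h2 := hy b
      simp only [Pi.add_apply] at h1 ⊢
      omega
    · have := N.exec_add [b] y z q
      simp only [exec] at this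
      rw [this]
      exact ih hw.2

/-- Completeness leaves no positive count and legality no negative one. -/
theorem exec_haltingWord (x : (Σ v, A v) → ℕ) (q : ∀ v, Q v) :
    N.exec (N.haltingWord h x q) (config x q) = (0, N.finalState h x q) := by
  have hs := Classical.choose_spec (h x q)
  refine Prod.ext (funext fun a => le_antisymm (hs.2 a) ?_) rfl
  exact hs.1.exec_nonneg N (fun a => Int.natCast_nonneg _) a

theorem run_haltingWord (x : (Σ v, A v) → ℕ) (q : ∀ v, Q v) :
    N.run (N.haltingWord h x q) q = N.finalState h x q := by
  have := N.exec_haltingWord h x q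
  rw [exec_eq] at this
  exact (Prod.ext_iff.1 this).2

theorem change_haltingWord (x : (Σ v, A v) → ℕ) (q : ∀ v, Q v) (a : Σ v, A v) :
    N.change (N.haltingWord h x q) q a = -(x a : ℤ) := by
  have := N.exec_haltingWord h x q
  rw [exec_eq] at this
  have := congrFun (congrArg Prod.fst this) a
  simp only [config, Pi.add_apply, Pi.zero_apply] at this
  omega

/-- One may first process `x` to the end while `y` waits, then `y`: the concatenation is again legal
and complete. Thus the final states define an action of `ℕ^A`. -/
theorem finalState_add (x y : (Σ v, A v) → ℕ) (q : ∀ v, Q v) :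
    N.finalState h (x + y) q = N.finalState h y (N.finalState h x q) := by
  have hx := Classical.choose_spec (h x q)
  have hy := Classical.choose_spec (h y (N.finalState h x q))
  have hcfg : (config (x + y) q : Config A Q) =
      ((fun a => (y a : ℤ)) + (config x q : Config A Q).1, q) := by
    refine Prod.ext (funext fun a => ?_) rfl
    simp [config, add_comm]
  have hex : N.exec (N.haltingWord h x q) (config (x + y) q) =
      config y (N.finalState h x q) := by
    have := N.exec_haltingWord h x q
    rw [hcfg, exec_add]
    change (_ + (N.exec (N.haltingWord h x q) (config x q)).1,
      (N.exec (N.haltingWord h x q) (config x q)).2) = _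
    rw [this, add_zero]
    rfl
  have hl : N.Legal (N.haltingWord h x q ++ N.haltingWord h y (N.finalState h x q))
      (config (x + y) q) := by
    refine Legal.append N ?_ ?_
    · rw [hcfg]
      exact hx.1.add N fun a => Int.natCast_nonneg _
    · rw [hex]
      exact hy.1
  have hc : N.Complete (N.haltingWord h x q ++ N.haltingWord h y (N.finalState h x q))
      (config (x + y) q) := by
    intro a
    rw [exec_append, hex]
    exact hy.2 a
  rw [(N.odometer_finalState_eq h _ q _ hl hc).2, exec_append, hex]
  rfl

theorem finalState_zero (q : ∀ v, Q v) : N.finalState h 0 q = q :=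
  (N.odometer_finalState_eq h 0 q [] trivial fun a => by simp [exec, config]).2

theorem exists_finalState_eq (m : N.globalMonoid h) :
    ∃ x, ∀ q : (∀ v, Q v), m • q = N.finalState h x q := by
  obtain ⟨m, hm⟩ := m
  induction hm using Submonoid.closure_induction with
  | mem m hm =>
    obtain ⟨a, rfl⟩ := hm
    exact ⟨Pi.single a 1, fun q => rfl⟩
  | one => exact ⟨0, fun q => (N.finalState_zero h q).symm⟩
  | mul m n hm hn ihm ihn =>
    obtain ⟨x, hx⟩ := ihm
    obtain ⟨y, hy⟩ := ihn
    refine ⟨y + x, fun q => ?_⟩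
    rw [finalState_add, ← hy, ← hx]
    rfl

theorem exists_smul_eq_finalState [Fintype V] [∀ v, Fintype (A v)] (x : (Σ v, A v) → ℕ) :
    ∃ m : N.globalMonoid h, ∀ q : (∀ v, Q v), m • q = N.finalState h x q := by
  induction x using Pi.single_induction with
  | zero => exact ⟨1, fun q => by rw [one_smul, finalState_zero]⟩
  | add x y hx hy =>
    obtain ⟨m, hm⟩ := hx
    obtain ⟨n, hn⟩ := hy
    exact ⟨n * m, fun q => by rw [mul_smul, hm, hn, finalState_add]⟩
  | single a k =>
    induction k with
    | zero => exact ⟨1, fun q => by rw [one_smul, Pi.single_zero, finalState_zero]⟩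
    | succ k ih =>
      obtain ⟨m, hm⟩ := ih
      refine ⟨⟨N.tau h a, Submonoid.subset_closure ⟨a, rfl⟩⟩ * m, fun q => ?_⟩
      rw [mul_smul, hm, Pi.single_add, finalState_add]
      rfl

/-! ### Recurrent states of the network. -/

theorem mem_Rec_iff [Fintype V] [∀ v, Fintype (A v)] (q : ∀ v, Q v) :
    q ∈ N.Rec h ↔ ∀ x, ∃ y, N.finalState h (x + y) q = q := by
  constructor
  · intro hq x
    obtain ⟨m, hm⟩ := N.exists_smul_eq_finalState h x
    obtain ⟨m', hm'⟩ := hq m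
    obtain ⟨y, hy⟩ := N.exists_finalState_eq h m'
    exact ⟨y, by rw [finalState_add, ← hm, ← hy, hm']⟩
  · intro hq m
    obtain ⟨x, hx⟩ := N.exists_finalState_eq h m
    obtain ⟨y, hy⟩ := hq x
    obtain ⟨m', hm'⟩ := N.exists_smul_eq_finalState h y
    exact ⟨m', by rw [hm', hx, ← finalState_add, hy]⟩

theorem finalState_mem_Rec [Fintype V] [∀ v, Fintype (A v)] {q : ∀ v, Q v} (hq : q ∈ N.Rec h)
    (x : (Σ v, A v) → ℕ) : N.finalState h x q ∈ N.Rec h := by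
  rw [mem_Rec_iff] at hq ⊢
  intro z
  obtain ⟨y, hy⟩ := hq (x + z)
  refine ⟨y + x, ?_⟩
  rw [← finalState_add, ← add_assoc, ← add_assoc, finalState_add, hy]

/-- Every input permutes the recurrent states. -/
theorem finalState_bijOn [Fintype V] [∀ v, Fintype (A v)] [∀ v, Finite (Q v)]
    (x : (Σ v, A v) → ℕ) : Set.BijOn (N.finalState h x) (N.Rec h) (N.Rec h) := by
  have hmaps : Set.MapsTo (N.finalState h x) (N.Rec h) (N.Rec h) := fun q hq =>
    N.finalState_mem_Rec h hq x
  have hsurj : Set.SurjOn (N.finalState h x) (N.Rec h) (N.Rec h) := fun q hq => by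
    obtain ⟨y, hy⟩ := (N.mem_Rec_iff h q).1 hq x
    refine ⟨N.finalState h y q, N.finalState_mem_Rec h hq y, ?_⟩
    rw [← finalState_add, add_comm, hy]
  exact ((Set.toFinite _).surjOn_iff_bijOn_of_mapsTo hmaps).1 hsurj

/-- The count of a letter that is never processed cannot decrease to zero. -/
theorem mem_haltingWord {x : (Σ v, A v) → ℕ} {a : Σ v, A v} (ha : 1 ≤ x a) (q : ∀ v, Q v) :
    a ∈ N.haltingWord h x q := by
  by_contra hn
  have h1 := N.le_exec_of_notMem a _ hn (config x q)
  rw [exec_haltingWord] at h1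
  simp only [config, Pi.zero_apply] at h1
  omega

theorem locallyRecurrent_of_mem_Rec [Fintype V] [∀ v, Fintype (A v)] {q : ∀ v, Q v}
    (hq : q ∈ N.Rec h) : N.LocallyRecurrent q := by
  intro v
  -- The all-ones input forces every letter to be processed on a loop at `q`, so each `q v` is fixed
  -- by a word containing its whole alphabet.
  obtain ⟨y, hy⟩ := (N.mem_Rec_iff h q).1 hq 1
  obtain ⟨u, hu, hr⟩ := N.exists_run_apply_eq (N.haltingWord h (1 + y) q) v
  refine (N.proc v).isRecurrentElt_of_act_eq (u := u) (fun a => hu a ?_) ?_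
  · exact N.mem_haltingWord h (by simp) q
  · rw [← hr, run_haltingWord, hy]

theorem Rec_nonempty [∀ v, Finite (Q v)] [Finite V] (hirr : N.Irreducible) :
    (N.Rec h).Nonempty := by
  obtain ⟨q, -⟩ := N.exists_locallyRecurrent hirr
  have : Nonempty (∀ v, Q v) := ⟨q⟩
  exact exists_isRecurrentElt (N.globalMonoid h) (∀ v, Q v)

/-! ### Averaging over the recurrent states. -/

variable [Fintype V] [∀ v, Fintype (A v)] [∀ v, Fintype (Q v)]

/-- The expected odometer is mapped to the input by the matrix `I - P`. -/
theorem mulVec_expectedOdometer (hirr : N.Irreducible) {q₀ : ∀ v, Q v}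
    (hq₀ : N.LocallyRecurrent q₀) (x : (Σ v, A v) → ℕ) :
    (1 - N.productionMatrix q₀).mulVec (N.expectedOdometer h x) = fun a => (x a : ℚ) := by
  obtain ⟨φ, hφ⟩ := N.exists_potential hirr hq₀
  set F := (Set.toFinite (N.Rec h)).toFinset with hF
  have hmem : ∀ q, q ∈ F ↔ q ∈ N.Rec h := fun q => Set.Finite.mem_toFinset _
  have hcard : ((N.Rec h).ncard : ℚ) = F.card := by
    rw [Set.ncard_eq_toFinset_card _ (Set.toFinite _)]
  have hcard0 : (F.card : ℚ) ≠ 0 := by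
    obtain ⟨q, hq⟩ := N.Rec_nonempty h hirr
    exact Nat.cast_ne_zero.2 (Finset.card_ne_zero_of_mem ((hmem q).2 hq))
  have hE : N.expectedOdometer h x = (F.card : ℚ)⁻¹ • ∑ q ∈ F,
      fun a => ((N.haltingWord h x q).count a : ℚ) := by
    funext a
    rw [expectedOdometer, hcard, ← hF, Pi.smul_apply, Finset.sum_apply, smul_eq_mul, div_eq_inv_mul]
    rfl
  funext a
  have hbij := N.finalState_bijOn h x
  -- The uniform measure on `Rec` is invariant under `x`, so the coboundary sums to zero.
  have hperm : ∑ q ∈ F, φ (N.finalState h x q) a = ∑ q ∈ F, φ q a :=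
    Finset.sum_bij (fun q _ => N.finalState h x q)
      (fun q hq => (hmem _).2 (hbij.mapsTo ((hmem q).1 hq)))
      (fun q hq q' hq' hqq => hbij.injOn ((hmem q).1 hq) ((hmem q').1 hq') hqq)
      (fun q hq => by
        obtain ⟨q', hq', hqq⟩ := hbij.surjOn ((hmem q).1 hq)
        exact ⟨q', (hmem q').2 hq', hqq⟩)
      (fun q _ => rfl)
  have hsum : ∑ q ∈ F, N.drift q₀ (N.haltingWord h x q) a = -(F.card * (x a : ℚ)) := by
    have h1 : ∀ q ∈ F, N.drift q₀ (N.haltingWord h x q) a =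
        -(x a : ℚ) - φ (N.finalState h x q) a + φ q a := fun q hq => by
      have h2 := hφ q (N.locallyRecurrent_of_mem_Rec h ((hmem q).1 hq)) (N.haltingWord h x q) a
      rw [change_haltingWord, run_haltingWord] at h2
      push_cast at h2
      linarith
    rw [Finset.sum_congr rfl h1, Finset.sum_add_distrib, Finset.sum_sub_distrib, hperm,
      Finset.sum_const, nsmul_eq_mul]
    ring
  have hdrift : (N.productionMatrix q₀ - 1).mulVec (∑ q ∈ F,
      fun a => ((N.haltingWord h x q).count a : ℚ)) =
        ∑ q ∈ F, N.drift q₀ (N.haltingWord h x q) :=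
    map_sum (Matrix.mulVecLin (N.productionMatrix q₀ - 1)) _ F
  rw [hE, Matrix.mulVec_smul, ← neg_sub, Matrix.neg_mulVec, hdrift, Pi.smul_apply, Pi.neg_apply,
    Finset.sum_apply, hsum, smul_eq_mul]
  field_simp

end

end AbelianNetwork

theorem theorem3p7 {V : Type*} [Fintype V] [DecidableEq V] {G : Digraph V}
    {A Q : V → Type*} [∀ v, Fintype (A v)] [∀ v, DecidableEq (A v)] [∀ v, Fintype (Q v)]
    (N : AbelianNetwork G A Q) (hirr : N.Irreducible) (hhalt : N.HaltsOnAllInputs) :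
    (N.Rec hhalt).Nonempty ∧ (∃ q₀, N.LocallyRecurrent q₀) ∧
      ∀ q₀, N.LocallyRecurrent q₀ →
        IsUnit (1 - N.productionMatrix q₀) ∧
        ∀ x : (Σ v, A v) → ℕ,
          N.expectedOdometer hhalt x =
            (1 - N.productionMatrix q₀)⁻¹.mulVec (fun a => (x a : ℚ)) := by
  refine ⟨N.Rec_nonempty hhalt hirr, N.exists_locallyRecurrent hirr, fun q₀ hq₀ => ?_⟩
  have hE := N.mulVec_expectedOdometer hhalt hirr hq₀
  -- The expected odometers of single letters are the columns of a right inverse; for a square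
  -- matrix this suffices.
  have hinv : (1 - N.productionMatrix q₀) *
      (Matrix.of fun a b => N.expectedOdometer hhalt (Pi.single b 1) a) = 1 := by
    ext a b
    have hab := congrFun (hE (Pi.single b 1)) a
    rw [Matrix.one_apply]
    simp only [Pi.single_apply, Nat.cast_ite, Nat.cast_one, Nat.cast_zero] at hab
    exact hab
  have hunit : IsUnit (1 - N.productionMatrix q₀) := IsUnit.of_mul_eq_one _ hinv
  refine ⟨hunit, fun x => ?_⟩
  rw [← hE x, Matrix.mulVec_mulVec,
    Matrix.nonsing_inv_mul _ ((Matrix.isUnit_iff_isUnit_det _).1 hunit), Matrix.one_mulVec]
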